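/- **Setting.** Let $T,k,l,b$ be integers with $1\le k<T$ and $l\ge 1$, and let $\log$ denote the logarithm to base 2. Fix a measurable scalar quantizer $Q$ of $\mathbb R$ with $l+1$ cells and levels $q_0,\dots,q_l$, such that $0$ lies in the cell of $q_0$; write $x_i(s)\in\{0,\dots,l\}$ for the index of the cell of $s[i]$, so $Q(s[i])=q_{x_i(s)}$. The SQuaTS system with $b$ bits uses $T$ bins of $l$ random codewords $c_{j,i}\in\{0,1\}^b$ ($1\le j\le l$, $1\le i\le T$), whose $Tlb$ bits are independent Bernoulli with mean $\ln(2)/k$ and independent of the signal, and the all-zero word $c_{0,i}=c_0$. The encoder maps the signal $s=(s[1],\dots,s[T])$ to the Boolean OR $y=\bigvee_{i=1}^T c_{x_i(s),i}\in\{0,1\}^b$. A *maximum likelihood (ML) decoder* chooses from $y$ a set $X$ of $k$ bins and a codeword index $j_i\in\{1,\dots,l\}$ for every $i\in X$ such that the conditional probability of $y$ given the codewords $\{c_{j_i,i}\}_{i\in X}$ (which is $1$ if their OR is $y$, and $0$ otherwise) is maximal, and outputs $\hat s[i]=q_{j_i}$ for $i\in X$ and $\hat s[i]=q_0$ for $i\notin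 X$. Let $$D_T(l)=\frac1T\sum_{i=1}^T\mathbb E\big[|s[i]-Q(s[i])|^2\big],\qquad \mathrm{MSE}_T=\mathbb E\Big[\frac1T\sum_{i=1}^T|s[i]-\hat s[i]|^2\Big],$$ the second expectation being over the signal and the codebook. **Statement.** There are a universal constant $C$ and a choice of the number of bits $b=b(T,k,l)$ with $b\le C(k\log T+k\log l)$ for all $1\le k<T$, $l\ge1$, such that the following holds. 1. (Complexity.) For all $1\le k<T$, $l\ge 1$, every codebook and every register value $y\in\{0,1\}^b$, the exhaustive search, which enumerates the $\binom Tk l^k$ candidates, compares the OR of the $k$ codewords of each candidate to $y$ bit by bit, and writes down the indices (those of the best candidate for $i\in X$, and $0$ for $i\notin X$), is an ML decoder, and it executes at most $$C\Big(\tbinom Tk l^kk^2\log T+\tbinom Tk l^kk^2\log l\Big)$$ elementary operations (bit operations, loop and branch steps, list extensions and writing of output entries). 2. (Performance.) Fix $l\ge1$ and $Q$, and let $T\to\infty$ with sparsity levels $k=k_T$, $1\le k_T<T$ for all large $T$, arbitrary laws of the signal $s\in\mathbb R^T$ and arbitrary ML decoders (any tie-breaking), with $b=b(T,k_T,l)$.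 (a) The probability that exactly $k_T$ of the samples are quantized to an index other than $0$ and that the decoder does not recover all the quantized samples (that is, the indices $x_i(s)$) tends to $0$. (b) Suppose that the average power $\frac1T\sum_i\mathbb E|s[i]|^2$ is finite and bounded in $T$ for all large $T$, and that, for all large $T$, either $k_T=\mathcal O(1)$ and almost surely at most $k_T$ samples are non-zero, or almost surely exactly $k_T$ samples are quantized to an index other than $0$. Then $\mathrm{MSE}_T-D_T(l)\to0$. -/

import Mathlib

open MeasureTheory ProbabilityTheory Filter Topology

namespace SQuaTS

/-! ### Programs with an operation count -/

/-- The outcome of a program: the value it returns and the number of elementary operations it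
has executed. Sequential composition adds the operation counts. -/
structure Counted (α : Type) where
  val : α
  ops : ℕ

namespace Counted

instance : Monad Counted where
  pure a := ⟨a, 0⟩
  bind x f := ⟨(f x.val).val, x.ops + (f x.val).ops⟩

/-- Charge for `n` elementary operations. -/
def tick (n : ℕ) : Counted Unit := ⟨(), n⟩

/-- `for a in as do acc := body acc a`; each round is charged one operation for the loop
control, in addition to what the body executes. -/
def loop {α β : Type} : List α → β → (β → α → Counted β) → Counted β
  | [], acc, _ => pure acc
  | a :: as, acc, body => do
      tick 1
      let acc' ← body acc a
      loop as acc' body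

end Counted

/-! ### Codebook, encoder register -/

/-- Registers (and codewords) of `b` bits. -/
abbrev Word (b : ℕ) : Type := Fin b → Bool

/-- A codebook: `T` bins, each with `l` codewords of `b` bits. The all-zero codeword that is
common to all bins is not stored. -/
abbrev Codebook (T l b : ℕ) : Type := Fin T → Fin l → Word b

/-- The codeword of index `j ∈ {0, …, l}` in the bin `i`: the all-zero word for `j = 0`, and
otherwise the `j`-th stored codeword of the bin. -/
def codeword {T l b : ℕ} (c : Codebook T l b) (i : Fin T) (j : Fin (l + 1)) : Word b :=
  Fin.cases (fun _ => false) (c i) j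

/-- The register after all `T` samples were encoded: the Boolean OR over `i` of the codeword of
index `x i` in the bin `i`, i.e. the bit `t` is set if and only if it is set in one of them. -/
def register {T l b : ℕ} (c : Codebook T l b) (x : Fin T → Fin (l + 1)) : Word b :=
  fun t => decide (∃ i, codeword c i (x i) t = true)

/-! ### The ML decoder -/

/-- A vector of indices `x` describes a collection of `k` (not all-zero) codewords from `k`
different bins: the chosen bins are those with `x i ≠ 0`, and `x i ∈ {1, …, l}` is the index of
the codeword chosen in such a bin. -/
def IsSelection {T l : ℕ} (k : ℕ) (x : Fin T → Fin (l + 1)) : Prop :=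
  (Finset.univ.filter (fun i => x i ≠ 0)).card = k

/-- The conditional probability of the register value `y` given that the encoder has used the
codewords with indices `x` (the encoder output is a deterministic function of them). -/
noncomputable def likelihood {T l b : ℕ} (c : Codebook T l b) (x : Fin T → Fin (l + 1))
    (y : Word b) : ENNReal :=
  PMF.pure (register c x) y

/-- `x` is a maximum likelihood choice of `k` codewords from different bins, given the
register `y`. -/
def IsMLSelection {T l b : ℕ} (k : ℕ) (c : Codebook T l b) (y : Word b)
    (x : Fin T → Fin (l + 1)) : Prop :=
  IsSelection k x ∧
    ∀ x' : Fin T → Fin (l + 1), IsSelection k x' → likelihood c x' y ≤ likelihood c x y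

/-! ### The exhaustive search that implements the ML decoder

Elementary operations are: reading a codeword or register bit and combining it with a one-bit
accumulator, a step of loop control or a branch, extending a list by one entry, and writing one
entry of the output. -/

/-- The bit `t` of the Boolean OR of a list of codewords. -/
def orBit {T l b : ℕ} (c : Codebook T l b) (sel : List (Fin T × Fin l)) (t : Fin b) :
    Counted Bool :=
  Counted.loop sel false (fun acc p => do
    Counted.tick 1
    return acc || c p.1 p.2 t)

/-- Compares, bit by bit, the Boolean OR of a list of codewords to the register. -/
def orEqRegister {T l b : ℕ} (c : Codebook T l b) (y : Word b) (sel : List (Fin T × Fin l)) :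
    Counted Bool :=
  Counted.loop (List.finRange b) true (fun acc t => do
    let o ← orBit c sel t
    Counted.tick 1
    return acc && (o == y t))

/-- Tests one candidate. The state holds the best candidate so far and whether its OR equals the
register; it is replaced if there is none yet, or if the new candidate is strictly better. -/
def visit {T l b : ℕ} (c : Codebook T l b) (y : Word b) (sel : List (Fin T × Fin l))
    (best : Option (List (Fin T × Fin l) × Bool)) :
    Counted (Option (List (Fin T × Fin l) × Bool)) := do
  let new ← orEqRegister c y sel
  Counted.tick 1
  match best with
  | none => return some (sel, new)
  | some (sel', old) => return (if new && !old then some (sel, new) else some (sel', old))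

/-- Scans all the ways to extend the partial candidate `sel` by one codeword from each of `m`
different bins of the list `bins`. A branch with fewer than `m` bins left is cut at once (the
number of bins left is known to the program). -/
def scan {T l b : ℕ} (c : Codebook T l b) (y : Word b) :
    List (Fin T) → ℕ → List (Fin T × Fin l) → Option (List (Fin T × Fin l) × Bool) →
      Counted (Option (List (Fin T × Fin l) × Bool))
  | _, 0, sel, best => do
      Counted.tick 1
      visit c y sel best
  | [], _ + 1, _, best => do
      Counted.tick 1
      return best
  | i :: rest, m + 1, sel, best => do
      Counted.tick 1
      if rest.length < m then
        return best
      else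
        let best' ← Counted.loop (List.finRange l) best (fun acc j => do
          Counted.tick 1
          scan c y rest m ((i, j) :: sel) acc)
        scan c y rest (m + 1) sel best'

/-- Writes the index vector of a candidate: `0` in all the `T` entries, and then the index of the
chosen codeword in each of the chosen bins. -/
def writeIndices {T l : ℕ} (sel : List (Fin T × Fin l)) : Counted (Fin T → Fin (l + 1)) := do
  Counted.tick T
  Counted.loop sel (fun _ => 0) (fun x p => do
    Counted.tick 1
    return Function.update x p.1 p.2.succ)

/-- The ML decoder as a program: it scans all the `(T choose k) * l ^ k` candidates, compares
their Boolean OR to the register, and writes the indices `j` of the recovered levels `q_j`. -/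
def mlDecode {T l b : ℕ} (k : ℕ) (c : Codebook T l b) (y : Word b) :
    Counted (Fin T → Fin (l + 1)) := do
  let best ← scan c y (List.finRange T) k [] none
  match best with
  | none => writeIndices []
  | some (sel, _) => writeIndices sel

/-! ### Quantizer, random codebook, distortion -/

/-- A scalar quantizer of `ℝ` with resolution `l + 1` that maps `0` to its level `q_0`. -/
structure Quantizer (l : ℕ) where
  /-- the (measurable) encoding function, i.e. the partition into decision regions -/
  label : ℝ → Fin (l + 1)
  measurable_label : Measurable label
  /-- the levels `q_0, …, q_l` -/
  level : Fin (l + 1) → ℝ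
  label_zero : label 0 = 0

/-- The indices of the quantized samples `Q(s[i])`. -/
def Quantizer.labels {l T : ℕ} (Q : Quantizer l) (s : Fin T → ℝ) : Fin T → Fin (l + 1) :=
  fun i => Q.label (s i)

/-- The encoder output for the signal `s`. -/
def encode {T l b : ℕ} (Q : Quantizer l) (c : Codebook T l b) (s : Fin T → ℝ) : Word b :=
  register c (Q.labels s)

/-- The mean value `ln 2 / k` of the codebook bits. -/
noncomputable def bitMean (k : ℕ) : unitInterval :=
  ⟨Real.log 2 / k, by
    constructor
    · positivity
    · rcases Nat.eq_zero_or_pos k with rfl | hk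
      · simp
      · have h1 : (1 : ℝ) ≤ k := by exact_mod_cast hk
        have h2 := Real.log_two_lt_d9
        rw [div_le_one (by linarith)]
        linarith⟩

/-- The law of the random codebook: all `T * l * b` bits are independent and Bernoulli with mean
`ln 2 / k`. -/
noncomputable def codebookLaw (T l b k : ℕ) : Measure (Codebook T l b) :=
  Measure.pi fun _ => Measure.pi fun _ => Measure.pi fun _ =>
    bernoulliMeasure true false (bitMean k)

/-- The average MSE `D_T(l)` of the scalar quantizer, applied to a signal with law `μ`. -/
noncomputable def scalarMSE {T l : ℕ} (Q : Quantizer l) (μ : Measure (Fin T → ℝ)) : ℝ :=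
  (1 / (T : ℝ)) * ∑ i, ∫ s, (s i - Q.level (Q.label (s i))) ^ 2 ∂μ

/-- The MSE `E[(1/T) ‖s - ŝ‖²]` of the system with the (first stage of the) decoder `dec`, where
the signal has law `μ`, the codebook is independent of it, and `ŝ[i] = q_j` when `j` is the
decoded index at `i`. -/
noncomputable def systemMSE {T l b : ℕ} (k : ℕ) (Q : Quantizer l) (μ : Measure (Fin T → ℝ))
    (dec : Codebook T l b → Word b → Fin T → Fin (l + 1)) : ℝ :=
  ∫ ω, (1 / (T : ℝ)) * ∑ i, (ω.1 i - Q.level (dec ω.2 (encode Q ω.2 ω.1) i)) ^ 2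
    ∂(μ.prod (codebookLaw T l b k))

/-- The probability, over signal and codebook, that exactly `k` samples are quantized to an index
other than `0` and that the decoder nevertheless does not recover the indices of all the quantized
samples. -/
noncomputable def errorProb {T l b : ℕ} (k : ℕ) (Q : Quantizer l) (μ : Measure (Fin T → ℝ))
    (dec : Codebook T l b → Word b → Fin T → Fin (l + 1)) : ENNReal :=
  (μ.prod (codebookLaw T l b k))
    {ω | IsSelection k (Q.labels ω.1) ∧ dec ω.2 (encode Q ω.2 ω.1) ≠ Q.labels ω.1}

end SQuaTS

/-! Recovery. For two index vectors with `k` non-zero entries at Hamming distance `h`, a given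
register bit differs as soon as all `k` codewords of the first have a zero there and one of the at
least `h / 2` codewords used only by the second has a one. With bit mean `ln 2 / k` the first event
has probability bounded below and the second has probability of order `h / k`, so all `b`
independent positions agree with probability at most `exp (-h b / (20 k))`
(`codebookLaw_real_register_eq_le`). With `b = 40 k (clog T + clog l)` this is `r ^ h` with `r ≤ 1 /
(T l) ^ 2`. The union bound over all competitors is the generating function `(1 + l r) ^ T - 1 ≤ exp
(1 / T) - 1` of the Hamming distance, which tends to `0` uniformly in `k` and the signal
(`codebookLaw_real_ambiguous_le`). An ML choice always reproduces the register, so it can only err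
when the codebook is ambiguous.

MSE. The excess distortion is controlled by the power and the expected fraction of wrong indices
(`abs_systemMSE_sub_scalarMSE_le`). That fraction is at most the error probability for exactly `k`
non-zero indices, and trivially `O(1 / T)` for bounded sparsity.

Complexity. The search tree has `T.choose k * l ^ k` leaves, and the cost of its inner nodes is
charged to the leaves (`ops_scan_le`). -/

namespace SQuaTS

/-! ### Values and operation counts of loops. -/

namespace Counted

variable {α β γ : Type}

@[simp] theorem val_pure (a : α) : (pure a : Counted α).val = a := rfl

@[simp] theorem ops_pure (a : α) : (pure a : Counted α).ops = 0 := rfl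

@[simp] theorem val_bind (x : Counted α) (f : α → Counted β) :
    (x >>= f).val = (f x.val).val := rfl

@[simp] theorem ops_bind (x : Counted α) (f : α → Counted β) :
    (x >>= f).ops = x.ops + (f x.val).ops := rfl

@[simp] theorem ops_tick (n : ℕ) : (tick n).ops = n := rfl

@[simp] theorem val_loop_nil (acc : β) (body : β → α → Counted β) :
    (loop [] acc body).val = acc := rfl

@[simp] theorem ops_loop_nil (acc : β) (body : β → α → Counted β) :
    (loop [] acc body).ops = 0 := rfl

@[simp] theorem val_loop_cons (a : α) (as : List α) (acc : β) (body : β → α → Counted β) :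
    (loop (a :: as) acc body).val = (loop as (body acc a).val body).val := rfl

@[simp] theorem ops_loop_cons (a : α) (as : List α) (acc : β) (body : β → α → Counted β) :
    (loop (a :: as) acc body).ops
      = 1 + ((body acc a).ops + (loop as (body acc a).val body).ops) := rfl

theorem ops_loop_le {B : ℕ} (as : List α) (acc : β) (body : β → α → Counted β)
    (h : ∀ acc a, (body acc a).ops ≤ B) : (loop as acc body).ops ≤ as.length * (B + 1) := by
  induction as generalizing acc with
  | nil => simp
  | cons a as ih =>
    have h1 := h acc a
    have h2 := ih (body acc a).val
    simp only [ops_loop_cons, List.length_cons]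
    rw [Nat.add_mul]
    omega

theorem loop_preserves {R : β → Prop} (as : List α) (acc : β) (body : β → α → Counted β)
    (h : ∀ a ∈ as, ∀ acc, R acc → R (body acc a).val) (h0 : R acc) :
    R (loop as acc body).val := by
  induction as generalizing acc with
  | nil => exact h0
  | cons a as ih =>
    rw [val_loop_cons]
    exact ih _ (fun a' ha' => h a' (List.mem_cons_of_mem _ ha'))
      (h a List.mem_cons_self acc h0)

theorem loop_establishes {R : β → Prop} (as : List α) (acc : β) (body : β → α → Counted β)
    (h : ∀ a ∈ as, ∀ acc, R acc → R (body acc a).val) {a : α} (ha : a ∈ as)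
    (h0 : ∀ acc, R (body acc a).val) : R (loop as acc body).val := by
  induction as generalizing acc with
  | nil => simp at ha
  | cons a' as ih =>
    rw [val_loop_cons]
    rcases List.mem_cons.1 ha with rfl | ha
    · exact loop_preserves as _ body (fun a' ha' => h a' (List.mem_cons_of_mem _ ha')) (h0 acc)
    · exact ih _ (fun a' ha' => h a' (List.mem_cons_of_mem _ ha')) ha

end Counted

/-! ### Correctness of the exhaustive search. -/

variable {T l b : ℕ} (c : Codebook T l b) (y : Word b)

/-- The Boolean OR of the listed codewords is the register value. -/
def Matches (sel : List (Fin T × Fin l)) : Prop :=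
  ∀ t, (∃ p ∈ sel, c p.1 p.2 t = true) ↔ y t = true

theorem val_orBit (sel : List (Fin T × Fin l)) (t : Fin b) :
    (orBit c sel t).val = true ↔ ∃ p ∈ sel, c p.1 p.2 t = true := by
  have key : ∀ (sel : List (Fin T × Fin l)) (acc : Bool),
      (Counted.loop sel acc (fun acc p => do
        Counted.tick 1
        return acc || c p.1 p.2 t)).val = true
        ↔ acc = true ∨ ∃ p ∈ sel, c p.1 p.2 t = true := by
    intro sel
    induction sel with
    | nil => simp
    | cons p sel ih =>
      intro acc
      rw [Counted.val_loop_cons, ih]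
      simp [or_assoc]
  exact (key sel false).trans (by simp)

theorem val_orEqRegister (sel : List (Fin T × Fin l)) :
    (orEqRegister c y sel).val = true ↔ Matches c y sel := by
  have key : ∀ (ts : List (Fin b)) (acc : Bool),
      (Counted.loop ts acc (fun acc t => do
        let o ← orBit c sel t
        Counted.tick 1
        return acc && (o == y t))).val = true
        ↔ acc = true ∧ ∀ t ∈ ts, (orBit c sel t).val = y t := by
    intro ts
    induction ts with
    | nil => simp
    | cons t ts ih =>
      intro acc
      rw [Counted.val_loop_cons, ih]
      simp [and_assoc]
  have h := key (List.finRange b) true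
  unfold orEqRegister
  rw [h]
  simp only [List.mem_finRange, true_and, forall_const, Matches, ← val_orBit, Bool.coe_iff_coe]

/-- The best candidate so far is at least as good as `sel`. -/
def Dominates (sel : List (Fin T × Fin l)) (best : Option (List (Fin T × Fin l) × Bool)) : Prop :=
  ∃ p, best = some p ∧ (Matches c y sel → p.2 = true)

/-- The state is only ever replaced by a strictly better one, so once it is at least as good as a
candidate it stays so. -/
theorem dominates_visit (sel : List (Fin T × Fin l))
    (best : Option (List (Fin T × Fin l) × Bool)) :
    Dominates c y sel (visit c y sel best).val := by
  unfold visit Dominates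
  rw [← val_orEqRegister]
  rcases best with _ | ⟨sel', old⟩
  · simp
  · cases h : (orEqRegister c y sel).val <;> cases old <;> simp [h]

theorem Dominates.visit {sel' : List (Fin T × Fin l)}
    {best : Option (List (Fin T × Fin l) × Bool)} (h : Dominates c y sel' best)
    (sel : List (Fin T × Fin l)) : Dominates c y sel' (visit c y sel best).val := by
  obtain ⟨⟨s, old⟩, rfl, hp⟩ := h
  unfold SQuaTS.visit Dominates
  cases h : (orEqRegister c y sel).val <;> cases old <;> simp_all

/-- The state consists of a selection satisfying `A` and the outcome of its comparison. -/
def Consistent (A : List (Fin T × Fin l) → Prop)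
    (best : Option (List (Fin T × Fin l) × Bool)) : Prop :=
  ∀ p, best = some p → A p.1 ∧ (p.2 = true → Matches c y p.1)

theorem Consistent.visit {A : List (Fin T × Fin l) → Prop}
    {best : Option (List (Fin T × Fin l) × Bool)} (h : Consistent c y A best)
    {sel : List (Fin T × Fin l)} (hsel : A sel) :
    Consistent c y A (visit c y sel best).val := by
  have hv := val_orEqRegister c y sel
  unfold SQuaTS.visit Consistent
  rcases best with _ | ⟨sel', old⟩
  · rintro p hp
    simp only [Counted.val_bind, Counted.val_pure, Option.some.injEq] at hp
    subst hp
    exact ⟨hsel, hv.1⟩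
  · have h' := h _ rfl
    intro p hp
    cases hn : (orEqRegister c y sel).val <;> cases old <;> simp_all <;> subst hp <;>
      simp_all

/-- Induction principle for the search: an invariant need only survive a `visit` at each leaf.
Codewords are pushed at the front, so the leaf reached by choosing `e` in bin order is `e.reverse ++
sel`. -/
theorem scan_preserves {R : Option (List (Fin T × Fin l) × Bool) → Prop}
    {A : List (Fin T × Fin l) → Prop}
    (hR : ∀ sel best, A sel → R best → R (visit c y sel best).val)
    (bins : List (Fin T)) (m : ℕ) (sel : List (Fin T × Fin l))
    (best : Option (List (Fin T × Fin l) × Bool))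
    (hA : ∀ e : List (Fin T × Fin l), (e.map Prod.fst).Sublist bins → e.length = m →
      A (e.reverse ++ sel))
    (h : R best) : R (scan c y bins m sel best).val := by
  induction bins generalizing m sel best with
  | nil =>
    cases m with
    | zero => exact hR _ _ (hA [] (by simp) rfl) h
    | succ m => exact h
  | cons i rest ih =>
    cases m with
    | zero => exact hR _ _ (hA [] (by simp) rfl) h
    | succ m =>
      rw [scan]
      simp only [Counted.val_bind]
      split_ifs with hlt
      · exact h
      · simp only [Counted.val_bind]
        apply ih
        · intro e he hm
          exact hA e (he.cons _) hm
        · apply Counted.loop_preserves _ _ _ _ h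
          intro j _ acc hacc
          simp only [Counted.val_bind]
          apply ih _ _ _ _ hacc
          intro e he hm
          have := hA ((i, j) :: e) (by simpa using he) (by simp [hm])
          simpa using this

/-- Completeness of the search: the branch that follows `e` is entered, its leaf establishes
dominance, and all later visits keep it. -/
theorem dominates_scan (bins : List (Fin T)) (m : ℕ) (sel : List (Fin T × Fin l))
    (best : Option (List (Fin T × Fin l) × Bool)) (e : List (Fin T × Fin l))
    (he : (e.map Prod.fst).Sublist bins) (hm : e.length = m) :
    Dominates c y (e.reverse ++ sel) (scan c y bins m sel best).val := by
  have hpres : ∀ (e' : List (Fin T × Fin l)) bins m sel best, Dominates c y e' best →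
      Dominates c y e' (scan c y bins m sel best).val := fun e' bins m sel best h =>
    scan_preserves c y (A := fun _ => True) (fun _ _ _ h => h.visit c y _) bins m sel best
      (fun _ _ _ => trivial) h
  induction bins generalizing m sel best e with
  | nil =>
    have : e = [] := by simpa using he
    subst this
    obtain rfl : m = 0 := by simpa using hm.symm
    exact dominates_visit c y _ _
  | cons i rest ih =>
    cases m with
    | zero =>
      have : e = [] := by simpa using hm
      subst this
      exact dominates_visit c y _ _
    | succ m =>
      rw [scan]
      have hlen := he.length_le
      simp only [List.length_map, List.length_cons] at hlen
      simp only [Counted.val_bind]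
      rw [if_neg (by omega)]
      simp only [Counted.val_bind]
      rcases e with _ | ⟨⟨i', j⟩, e⟩
      · simp at hm
      -- Either `e` avoids the bin `i` and is found by the final recursive call, or its first
      -- codeword lies in bin `i` and is found in round `j` of the loop.
      · by_cases hi : (List.map Prod.fst ((i', j) :: e)).Sublist rest
        · exact ih _ _ _ _ hi hm
        · have h2 : i' = i ∧ (e.map Prod.fst).Sublist rest := by
            rw [List.map_cons] at he hi
            cases he with
            | cons _ h => exact absurd h hi
            | cons_cons _ h => exact ⟨rfl, h⟩
          obtain ⟨rfl, h2⟩ := h2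
          apply hpres
          apply Counted.loop_establishes _ _ _ _ (List.mem_finRange j)
          · intro acc
            have := ih m ((i', j) :: sel) acc e h2 (by simpa using hm)
            simpa using this
          · intro a _ acc hacc
            exact hpres _ _ _ _ _ hacc

/-- A list of codewords from `k` different bins. -/
def IsCandidate (k : ℕ) (sel : List (Fin T × Fin l)) : Prop :=
  sel.length = k ∧ (sel.map Prod.fst).Nodup

/-- Distinct bins guarantee that no entry is overwritten. -/
theorem val_writeIndices {sel : List (Fin T × Fin l)} (h : (sel.map Prod.fst).Nodup) (i : Fin T)
    (j : Fin l) : (writeIndices sel).val i = j.succ ↔ (i, j) ∈ sel := by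
  have key : ∀ (sel : List (Fin T × Fin l)) (x : Fin T → Fin (l + 1)),
      (sel.map Prod.fst).Nodup → (∀ p ∈ sel, x p.1 = 0) →
      ((Counted.loop sel x (fun x p => do
        Counted.tick 1
        return Function.update x p.1 p.2.succ)).val i = j.succ ↔ x i = j.succ ∨ (i, j) ∈ sel) := by
    intro sel
    induction sel with
    | nil => simp
    | cons p sel ih =>
      intro x hn hx
      rw [List.map_cons, List.nodup_cons] at hn
      have hne : ∀ q ∈ sel, q.1 ≠ p.1 := by
        intro q hq hqp
        exact hn.1 (hqp ▸ List.mem_map_of_mem hq)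
      rw [Counted.val_loop_cons, ih _ hn.2]
      · obtain ⟨i', j'⟩ := p
        have h0 := hx (i', j') List.mem_cons_self
        simp only at h0
        by_cases hi : i = i'
        · subst hi
          simp [h0, (Fin.succ_ne_zero j).symm, eq_comm]
        · simp [hi]
      · intro q hq
        simp only [Counted.val_bind, Counted.val_pure]
        rw [Function.update_of_ne (hne q hq)]
        exact hx q (List.mem_cons_of_mem _ hq)
  have := key sel (fun _ => 0) h (by simp)
  simpa [writeIndices, (Fin.succ_ne_zero j).symm] using this

theorem register_eq_true (x : Fin T → Fin (l + 1)) (t : Fin b) :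
    register c x t = true ↔ ∃ i j, x i = Fin.succ j ∧ c i j t = true := by
  simp only [register, decide_eq_true_eq]
  refine exists_congr fun i => ?_
  generalize x i = a
  cases a using Fin.cases with
  | zero => simp [codeword, (Fin.succ_ne_zero _).symm]
  | succ j => simp [codeword, Fin.succ_inj]

theorem matches_iff_register {sel : List (Fin T × Fin l)} {x : Fin T → Fin (l + 1)}
    (h : ∀ i j, x i = Fin.succ j ↔ (i, j) ∈ sel) : Matches c y sel ↔ register c x = y := by
  rw [funext_iff]
  refine forall_congr' fun t => ?_
  have h1 : register c x t = true ↔ ∃ p ∈ sel, c p.1 p.2 t = true := by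
    rw [register_eq_true]
    simp only [h, Prod.exists]
  rw [← h1]
  exact Bool.coe_iff_coe

theorem isSelection_of_isCandidate {k : ℕ} {sel : List (Fin T × Fin l)} (hs : IsCandidate k sel)
    {x : Fin T → Fin (l + 1)} (h : ∀ i j, x i = Fin.succ j ↔ (i, j) ∈ sel) : IsSelection k x := by
  have : Finset.univ.filter (fun i => x i ≠ 0) = (sel.map Prod.fst).toFinset := by
    ext i
    simp only [Finset.mem_filter, Finset.mem_univ, true_and, List.mem_toFinset, List.mem_map,
      Prod.exists, exists_and_right, exists_eq_right, ← h]
    exact ⟨fun hi => ⟨_, (Fin.succ_pred _ hi).symm⟩, fun ⟨j, hj⟩ => hj ▸ Fin.succ_ne_zero j⟩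
  rw [IsSelection, this, List.toFinset_card_of_nodup hs.2, List.length_map, hs.1]

/-- Listing the non-zero positions in increasing order gives the candidate in the order in which
`scan` builds it. -/
theorem IsSelection.exists_list {k : ℕ} {x : Fin T → Fin (l + 1)} (hx : IsSelection k x) :
    ∃ e : List (Fin T × Fin l), (e.map Prod.fst).Sublist (List.finRange T) ∧ e.length = k ∧
      ∀ i j, x i = Fin.succ j ↔ (i, j) ∈ e := by
  let f : {i : Fin T // x i ≠ 0} → Fin T × Fin l := fun i => (i.1, (x i.1).pred i.2)
  let s := (List.finRange T).filter (fun i => x i ≠ 0)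
  have hs : ∀ i ∈ s, x i ≠ 0 := fun i hi => by simpa [s] using (List.mem_filter.1 hi).2
  have hmap : ((s.attachWith _ hs).map f).map Prod.fst = s := by
    simp [f, Function.comp_def]
  refine ⟨(s.attachWith _ hs).map f, ?_, ?_, fun i j => ?_⟩
  · rw [hmap]
    exact List.filter_sublist
  · rw [← List.length_map (f := Prod.fst), hmap, ← hx,
      ← List.toFinset_card_of_nodup ((List.nodup_finRange T).filter _)]
    congr 1
    ext i
    simp
  · simp only [List.mem_map, List.mem_attachWith, Subtype.exists, f, s, Prod.mk.injEq]
    constructor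
    · intro h
      have h0 : x i ≠ 0 := h ▸ Fin.succ_ne_zero j
      refine ⟨i, h0, by simpa using h0, rfl, ?_⟩
      simp [h]
    · rintro ⟨i', h0, _, rfl, rfl⟩
      simp

theorem exists_isSelection {k : ℕ} (hk : k ≤ T) (hl : 1 ≤ l) :
    ∃ x : Fin T → Fin (l + 1), IsSelection k x := by
  obtain ⟨s, -, hs⟩ := Finset.exists_subset_card_eq
    (s := (Finset.univ : Finset (Fin T))) (n := k) (by simpa using hk)
  refine ⟨fun i => if i ∈ s then Fin.last l else 0, ?_⟩
  rw [IsSelection, ← hs]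
  congr 1
  ext i
  have : Fin.last l ≠ 0 := by
    rw [Ne, Fin.ext_iff]
    simp
    omega
  simp [this]

theorem likelihood_eq (x : Fin T → Fin (l + 1)) :
    likelihood c x y = if register c x = y then 1 else 0 := by
  rw [likelihood, PMF.pure_apply]
  simp only [eq_comm (a := y)]

/-- `Consistent` says that the stored flag is never falsely true, `Dominates` that it is true if any
candidate matches. As the likelihood is `0` or `1`, this is maximality. -/
theorem isMLSelection_mlDecode {k : ℕ} (hk : k ≤ T) (hl : 1 ≤ l) :
    IsMLSelection k c y (mlDecode k c y).val := by
  have hcons : Consistent c y (IsCandidate k) (scan c y (List.finRange T) k [] none).val := by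
    apply scan_preserves c y (R := Consistent c y (IsCandidate k)) (A := IsCandidate k)
      (fun _ _ hA h => Consistent.visit c y h hA)
    · intro e he hm
      refine ⟨by simpa using hm, ?_⟩
      simpa using (he.nodup (List.nodup_finRange T))
    · simp [Consistent]
  have hdom : ∀ e : List (Fin T × Fin l), (e.map Prod.fst).Sublist (List.finRange T) →
      e.length = k → Dominates c y (e.reverse ++ []) (scan c y (List.finRange T) k [] none).val :=
    fun e he hm => dominates_scan c y _ _ _ _ e he hm
  unfold mlDecode
  simp only [Counted.val_bind]
  generalize (scan c y (List.finRange T) k [] none).val = best at hcons hdom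
  have hsome : ∃ p, best = some p := by
    obtain ⟨x, hx⟩ := exists_isSelection hk hl
    obtain ⟨e, he, hm, -⟩ := hx.exists_list
    obtain ⟨p, hp, -⟩ := hdom e he hm
    exact ⟨p, hp⟩
  obtain ⟨⟨sel, f⟩, rfl⟩ := hsome
  obtain ⟨hc, hf⟩ := hcons _ rfl
  have hw := val_writeIndices hc.2
  refine ⟨isSelection_of_isCandidate hc hw, fun x' hx' => ?_⟩
  rw [likelihood_eq, likelihood_eq]
  by_cases h' : register c x' = y
  · obtain ⟨e, he, hm, hmem⟩ := hx'.exists_list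
    obtain ⟨p, hp, hp2⟩ := hdom e he hm
    obtain rfl := Option.some.inj hp
    have : Matches c y (e.reverse ++ []) :=
      (matches_iff_register c y (by simpa using hmem)).2 h'
    rw [if_pos ((matches_iff_register c y hw).1 (hf (hp2 this)))]
    split_ifs
    simp
  · simp [h']

end SQuaTS

/-! ### Operation count of the search and size of the register. -/

namespace SQuaTS

variable {T l b : ℕ} (c : Codebook T l b) (y : Word b)

theorem ops_orEqRegister_le (sel : List (Fin T × Fin l)) :
    (orEqRegister c y sel).ops ≤ b * (2 * sel.length + 2) := by
  have h := Counted.ops_loop_le (B := 2 * sel.length + 1) (List.finRange b) true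
    (fun acc t => do
      let o ← orBit c sel t
      Counted.tick 1
      return acc && (o == y t)) (by
    intro acc t
    have := Counted.ops_loop_le (B := 1) sel false (fun acc p => do
      Counted.tick 1
      return acc || c p.1 p.2 t) (fun _ _ => by simp)
    simp only [Counted.ops_bind, Counted.ops_tick, Counted.ops_pure, orBit]
    omega)
  rw [List.length_finRange] at h
  exact h

theorem ops_visit_le (sel : List (Fin T × Fin l))
    (best : Option (List (Fin T × Fin l) × Bool)) :
    (visit c y sel best).ops ≤ b * (2 * sel.length + 2) + 1 := by
  have := ops_orEqRegister_le c y sel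
  rcases best with _ | ⟨sel', old⟩ <;>
  · simp only [visit, Counted.ops_bind, Counted.ops_tick, Counted.ops_pure]
    omega

/-- A dead branch has no leaves to charge but still costs one operation, so it is kept out of the
bound by leaf count and paid for by its parent. -/
theorem ops_scan_of_lt {bins : List (Fin T)} {m : ℕ} (h : bins.length < m)
    (sel : List (Fin T × Fin l)) (best : Option (List (Fin T × Fin l) × Bool)) :
    (scan c y bins m sel best).ops = 1 := by
  rcases bins with _ | ⟨i, rest⟩ <;> rcases m with _ | m
  · simp at h
  · rfl
  · simp at h
  · rw [scan]
    simp only [List.length_cons] at h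
    simp only [Counted.ops_bind]
    rw [if_pos (by omega)]
    rfl

/-- Pascal's rule splits the leaves into those using the first bin and those skipping it. A leaf
costs at most `b * (2 * k + 2) + 2`; a node costs at most `2 + 2 * l` extra, at most `4` per leaf
below its loop, whence `4 * m` over `m` levels. -/
theorem ops_scan_le {k : ℕ} (hl : 1 ≤ l) (bins : List (Fin T)) (m : ℕ)
    (sel : List (Fin T × Fin l)) (best : Option (List (Fin T × Fin l) × Bool))
    (hm : m ≤ bins.length) (hk : sel.length + m = k) :
    (scan c y bins m sel best).ops
      ≤ bins.length.choose m * l ^ m * (b * (2 * k + 2) + 2 + 4 * m) := by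
  have h0 : ∀ (bins : List (Fin T)) (sel : List (Fin T × Fin l)) best, sel.length + 0 = k →
      (do Counted.tick 1; visit c y sel best).ops
        ≤ bins.length.choose 0 * l ^ 0 * (b * (2 * k + 2) + 2 + 4 * 0) := by
    intro bins sel best hk
    have := ops_visit_le c y sel best
    simp only [add_zero] at hk
    rw [hk] at this
    simp only [Counted.ops_bind, Counted.ops_tick, Nat.choose_zero_right, pow_zero]
    omega
  induction bins generalizing m sel best with
  | nil =>
    obtain rfl : m = 0 := by simpa using hm
    exact h0 _ _ _ hk
  | cons i rest ih =>
    cases m with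
    | zero => exact h0 (i :: rest) _ _ hk
    | succ m =>
      simp only [List.length_cons, Nat.add_le_add_iff_right] at hm
      set V := b * (2 * k + 2) + 2 with hV
      set N := rest.length.choose m * l ^ m with hN
      have hN1 : 1 ≤ N := Nat.mul_pos (Nat.choose_pos hm) (Nat.pow_pos hl)
      have hloop := Counted.ops_loop_le (B := 1 + N * (V + 4 * m)) (List.finRange l) best
        (fun acc j => do
          Counted.tick 1
          scan c y rest m ((i, j) :: sel) acc) (by
        intro acc j
        have := ih m ((i, j) :: sel) acc hm (by simp; omega)
        rw [← hN] at this
        simp only [Counted.ops_bind, Counted.ops_tick]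
        omega)
      rw [List.length_finRange] at hloop
      have hrec : ∀ best', (scan c y rest (m + 1) sel best').ops
          ≤ 1 + rest.length.choose (m + 1) * l ^ (m + 1) * (V + 4 * (m + 1)) := by
        intro best'
        rcases lt_or_ge rest.length (m + 1) with h | h
        · rw [ops_scan_of_lt c y h]
          omega
        · exact (ih (m + 1) sel best' h hk).trans (Nat.le_add_left _ _)
      rw [scan]
      simp only [Counted.ops_bind, Counted.ops_tick]
      rw [if_neg (by omega)]
      simp only [Counted.ops_bind]
      refine (Nat.add_le_add_left (Nat.add_le_add hloop (hrec _)) 1).trans ?_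
      rw [List.length_cons, Nat.choose_succ_succ]
      have e1 : (rest.length.choose m + rest.length.choose (m + 1)) * l ^ (m + 1)
          * (V + 4 * (m + 1)) = l * (N * (V + 4 * m)) + 4 * (l * N)
            + rest.length.choose (m + 1) * l ^ (m + 1) * (V + 4 * (m + 1)) := by
        rw [hN]
        ring
      have e2 : l * 1 ≤ l * N := Nat.mul_le_mul_left l hN1
      rw [Nat.succ_eq_add_one, e1]
      nlinarith

theorem ops_writeIndices_le (sel : List (Fin T × Fin l)) :
    (writeIndices sel).ops ≤ T + 2 * sel.length := by
  have := Counted.ops_loop_le (B := 1) sel (fun _ : Fin T => (0 : Fin (l + 1))) (fun x p => do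
    Counted.tick 1
    return Function.update x p.1 p.2.succ) (fun _ _ => by simp)
  simp only [writeIndices, Counted.ops_bind, Counted.ops_tick]
  omega

theorem ops_mlDecode_le {k : ℕ} (hk : k ≤ T) (hl : 1 ≤ l) :
    (mlDecode k c y).ops
      ≤ T.choose k * l ^ k * (b * (2 * k + 2) + 2 + 4 * k) + (T + 2 * k) := by
  have hcons : Consistent c y (fun sel => sel.length = k)
      (scan c y (List.finRange T) k [] none).val := by
    apply scan_preserves c y (R := Consistent c y fun sel => sel.length = k)
      (A := fun sel => sel.length = k)
      (fun _ _ hA h => Consistent.visit c y h hA)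
    · intro e _ hm
      simpa using hm
    · simp [Consistent]
  have hscan := ops_scan_le (k := k) c y hl (List.finRange T) k [] none (by simpa) (by simp)
  rw [List.length_finRange] at hscan
  unfold mlDecode
  simp only [Counted.ops_bind]
  generalize (scan c y (List.finRange T) k [] none).val = best at hcons
  refine Nat.add_le_add hscan ?_
  rcases best with _ | ⟨sel, f⟩
  · exact (ops_writeIndices_le []).trans (by simp)
  · have := (hcons _ rfl).1
    simp only at this
    exact this ▸ ops_writeIndices_le sel

/-- A register size for which the maximum likelihood decoder succeeds. -/
def registerSize (T k l : ℕ) : ℕ := 40 * k * (Nat.clog 2 T + Nat.clog 2 l)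

/-- There is no additive constant: at `n = 1` both sides vanish, and for `n ≥ 2` rounding up costs
at most `1 ≤ logb 2 n`. -/
theorem clog_two_le (n : ℕ) (hn : 1 ≤ n) : (Nat.clog 2 n : ℝ) ≤ 2 * Real.logb 2 n := by
  rcases eq_or_lt_of_le hn with rfl | hn
  · simp
  · have h1 : (1 : ℝ) ≤ Real.logb 2 n := by
      rw [Real.le_logb_iff_rpow_le (by norm_num) (by positivity)]
      simpa using (by exact_mod_cast hn : (2 : ℝ) ≤ n)
    have h2 : (Nat.clog 2 n : ℝ) < Real.logb 2 n + 1 := by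
      have h3 : 2 ^ (Nat.clog 2 n).pred < n := Nat.pow_pred_clog_lt_self (by norm_num) hn
      have h4 : 0 < Nat.clog 2 n := Nat.clog_pos (by norm_num) hn
      have h5 : ((Nat.clog 2 n).pred : ℝ) < Real.logb 2 n := by
        rw [Real.lt_logb_iff_rpow_lt (by norm_num) (by positivity), Real.rpow_natCast]
        exact_mod_cast h3
      have h6 : ((Nat.clog 2 n).pred : ℝ) + 1 = Nat.clog 2 n := by
        exact_mod_cast Nat.succ_pred_eq_of_pos h4
      linarith
    linarith

theorem registerSize_le {T k l : ℕ} (hT : 1 ≤ T) (hl : 1 ≤ l) :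
    (registerSize T k l : ℝ) ≤ 80 * (k * Real.logb 2 T + k * Real.logb 2 l) := by
  have h1 := mul_le_mul_of_nonneg_left (clog_two_le T hT) (Nat.cast_nonneg (α := ℝ) k)
  have h2 := mul_le_mul_of_nonneg_left (clog_two_le l hl) (Nat.cast_nonneg (α := ℝ) k)
  simp only [registerSize]
  push_cast
  nlinarith

/-- Lets the `T` writes of the output be absorbed into the number of candidates. -/
theorem le_choose_of_pos_of_lt {T k : ℕ} (hk : 1 ≤ k) (hkT : k < T) : T ≤ T.choose k := by
  induction T generalizing k with
  | zero => simp
  | succ n ih =>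
    obtain ⟨k, rfl⟩ := Nat.exists_eq_succ_of_ne_zero (by omega : k ≠ 0)
    rw [Nat.succ_eq_add_one, Nat.choose_succ_succ]
    rcases Nat.eq_zero_or_pos k with rfl | h0
    · simp [Nat.add_comm]
    · have := ih h0 (by omega)
      have : 0 < n.choose (k + 1) := Nat.choose_pos (by omega)
      show n + 1 ≤ n.choose k + n.choose (k + 1)
      omega

theorem ops_mlDecode_registerSize_le {T k l : ℕ} (hk : 1 ≤ k) (hkT : k < T) (hl : 1 ≤ l)
    (c : Codebook T l (registerSize T k l)) (y : Word (registerSize T k l)) :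
    ((mlDecode k c y).ops : ℝ) ≤
      400 * ((T.choose k : ℝ) * (l : ℝ) ^ k * (k : ℝ) ^ 2 * Real.logb 2 T +
        (T.choose k : ℝ) * (l : ℝ) ^ k * (k : ℝ) ^ 2 * Real.logb 2 l) := by
  have h := ops_mlDecode_le c y hkT.le hl
  have hN : T ≤ T.choose k * l ^ k :=
    (le_choose_of_pos_of_lt hk hkT).trans (Nat.le_mul_of_pos_right _ (Nat.pow_pos hl))
  have h2 : (mlDecode k c y).ops
      ≤ T.choose k * l ^ k * (registerSize T k l * (4 * k) + 9 * k) := by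
    refine h.trans ?_
    have h3 : registerSize T k l * (2 * k + 2) ≤ registerSize T k l * (4 * k) :=
      Nat.mul_le_mul_left _ (by omega)
    have h4 : T + 2 * k ≤ T.choose k * l ^ k * 3 := by omega
    calc _ ≤ T.choose k * l ^ k * (registerSize T k l * (2 * k + 2) + 2 + 4 * k)
          + T.choose k * l ^ k * 3 := Nat.add_le_add_left h4 _
      _ = T.choose k * l ^ k * (registerSize T k l * (2 * k + 2) + 2 + 4 * k + 3) := by ring
      _ ≤ _ := Nat.mul_le_mul_left _ (by omega)
  have hb := registerSize_le (k := k) (by omega : 1 ≤ T) hl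
  have hlog : 1 ≤ Real.logb 2 T := by
    rw [Real.le_logb_iff_rpow_le (by norm_num) (by exact_mod_cast (by omega : 0 < T))]
    simpa using (by exact_mod_cast (by omega : 2 ≤ T) : (2 : ℝ) ≤ T)
  have hlogl : 0 ≤ Real.logb 2 l := Real.logb_nonneg (by norm_num) (by exact_mod_cast hl)
  have hk' : (1 : ℝ) ≤ k := by exact_mod_cast hk
  have h5 : ((mlDecode k c y).ops : ℝ)
      ≤ T.choose k * (l : ℝ) ^ k * (registerSize T k l * (4 * k) + 9 * k) := by exact_mod_cast h2
  refine h5.trans ?_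
  -- The constants add to `80 * 4 + 9 = 329`; the term `9 * k` is absorbed using `1 ≤ k` and `1 ≤
  -- logb 2 T`.
  have h6 : (registerSize T k l : ℝ) * (4 * k) + 9 * k
      ≤ 400 * ((k : ℝ) ^ 2 * (Real.logb 2 T + Real.logb 2 l)) := by
    have h7 : (registerSize T k l : ℝ) * (4 * k)
        ≤ 80 * (k * Real.logb 2 T + k * Real.logb 2 l) * (4 * k) :=
      mul_le_mul_of_nonneg_right hb (by positivity)
    have h8 : (k : ℝ) * 1 ≤ k * (k * (Real.logb 2 T + Real.logb 2 l)) := by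
      apply mul_le_mul_of_nonneg_left _ (by positivity)
      nlinarith
    nlinarith
  calc _ ≤ T.choose k * (l : ℝ) ^ k * (400 * ((k : ℝ) ^ 2 * (Real.logb 2 T + Real.logb 2 l))) :=
        mul_le_mul_of_nonneg_left h6 (by positivity)
    _ = _ := by ring

end SQuaTS

/-! ### Random codebooks and the error probability. -/

namespace SQuaTS

/-- The law of independent bits with mean `ln 2 / k`. -/
noncomputable def bitsLaw (ι : Type*) [Fintype ι] (k : ℕ) : Measure (ι → Bool) :=
  Measure.pi fun _ => bernoulliMeasure true false (bitMean k)

instance (ι : Type*) [Fintype ι] (k : ℕ) : IsProbabilityMeasure (bitsLaw ι k) := by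
  unfold bitsLaw
  infer_instance

instance (T l b k : ℕ) : IsProbabilityMeasure (codebookLaw T l b k) := by
  unfold codebookLaw
  infer_instance

theorem bitsLaw_real_forall_false {ι : Type*} [Fintype ι] [DecidableEq ι] (k : ℕ)
    (S : Finset ι) :
    (bitsLaw ι k).real {a | ∀ p ∈ S, a p = false} = (1 - Real.log 2 / k) ^ S.card := by
  have hset : {a : ι → Bool | ∀ p ∈ S, a p = false}
      = Set.pi Set.univ fun p => if p ∈ S then {false} else Set.univ := by
    ext a
    simp only [Set.mem_ofPred_eq, Set.mem_pi, Set.mem_univ, forall_const]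
    refine forall_congr' fun p => ?_
    split_ifs with h <;> simp [h]
  rw [hset, measureReal_def, bitsLaw, Measure.pi_pi, ENNReal.toReal_prod]
  have hval : ∀ p, ((bernoulliMeasure true false (bitMean k))
      (if p ∈ S then {false} else Set.univ)).toReal
        = if p ∈ S then 1 - Real.log 2 / k else 1 := by
    intro p
    split_ifs
    · rw [← measureReal_def, bernoulliMeasure_real_apply _ (MeasurableSet.of_discrete)]
      simp [bitMean]
    · simp
  simp only [hval, Finset.prod_ite_mem, Finset.univ_inter, Finset.prod_const]

/-- The two ORs differ when every bit of `S` is zero and some bit of `S' \ S` is one; this event is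
`A \ B` in the proof. -/
theorem bitsLaw_real_exists_iff_le {ι : Type*} [Fintype ι] [DecidableEq ι] (k : ℕ)
    (S S' : Finset ι) :
    (bitsLaw ι k).real {a | (∃ p ∈ S, a p = true) ↔ ∃ p ∈ S', a p = true}
      ≤ 1 - (1 - Real.log 2 / k) ^ S.card * (1 - (1 - Real.log 2 / k) ^ (S' \ S).card) := by
  set A : Set (ι → Bool) := {a | ∀ p ∈ S, a p = false} with hA
  set B : Set (ι → Bool) := {a | ∀ p ∈ S ∪ S', a p = false} with hB
  have hBA : B ⊆ A := fun a ha p hp => ha p (Finset.mem_union_left _ hp)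
  have hsub : {a : ι → Bool | (∃ p ∈ S, a p = true) ↔ ∃ p ∈ S', a p = true} ⊆ (A \ B)ᶜ := by
    rintro a ha ⟨haA, haB⟩
    apply haB
    have h1 : ¬ ∃ p ∈ S', a p = true := fun h => by
      obtain ⟨p, hp, hp'⟩ := ha.2 h
      rw [haA p hp] at hp'
      exact Bool.false_ne_true hp'
    intro p hp
    rcases Finset.mem_union.1 hp with hp | hp
    · exact haA p hp
    · by_contra hne
      exact h1 ⟨p, hp, by simpa using hne⟩
  refine (measureReal_mono hsub).trans ?_
  rw [probReal_compl_eq_one_sub MeasurableSet.of_discrete,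
    measureReal_sdiff hBA MeasurableSet.of_discrete, hA, hB, bitsLaw_real_forall_false,
    bitsLaw_real_forall_false, ← Finset.union_sdiff_self_eq_union,
    Finset.card_union_of_disjoint Finset.disjoint_sdiff, pow_add]
  apply le_of_eq
  ring

/-- Bernoulli's inequality gives `(1 - p) ^ k ≥ 1 - ln 2 ≥ 0.3`, the other factor is at least `0.34
* d / k`, and `0.3 * 0.34 > 1 / 10`. -/
theorem agreement_le_exp {k d : ℕ} (hk : 1 ≤ k) (hd : d ≤ k) :
    1 - (1 - Real.log 2 / k) ^ k * (1 - (1 - Real.log 2 / k) ^ d)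
      ≤ Real.exp (-(d / (10 * k) : ℝ)) := by
  have hk0 : (1 : ℝ) ≤ k := by exact_mod_cast hk
  have h1 := Real.log_two_gt_d9
  have h2 := Real.log_two_lt_d9
  have hkne : (k : ℝ) ≠ 0 := by positivity
  set p : ℝ := Real.log 2 / k with hp
  have hp0 : 0 ≤ p := by positivity
  have hp1 : p ≤ 1 := by
    rw [hp, div_le_one (by linarith)]
    linarith
  have hA : (0.3 : ℝ) ≤ (1 - p) ^ k := by
    have := one_add_mul_le_pow (a := -p) (by linarith) k
    have e : (k : ℝ) * p = Real.log 2 := by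
      rw [hp]
      field_simp
    rw [← sub_eq_add_neg] at this
    nlinarith
  set u : ℝ := d / k with hu
  have hu0 : 0 ≤ u := by positivity
  have hu1 : u ≤ 1 := by
    rw [hu, div_le_one (by linarith)]
    exact_mod_cast hd
  have hpd : p * d = Real.log 2 * u := by
    rw [hp, hu]
    ring
  -- With `v = ln 2 * u` in `[0, 1]`, `exp (-v) ≤ 1 / (1 + v) ≤ 1 - v / 2`, and `ln 2 / 2 > 0.34`.
  have hB : 0.34 * u ≤ 1 - (1 - p) ^ d := by
    have h3 : (1 - p) ^ d ≤ Real.exp (-p) ^ d :=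
      pow_le_pow_left₀ (by linarith) (Real.one_sub_le_exp_neg p) d
    rw [← Real.exp_nat_mul] at h3
    have h4 : (d : ℝ) * -p = -(Real.log 2 * u) := by linarith
    rw [h4, Real.exp_neg] at h3
    set v := Real.log 2 * u with hv
    have hv0 : 0 ≤ v := by positivity
    have hv1 : v ≤ 1 := by nlinarith
    have h5 : (Real.exp v)⁻¹ ≤ (1 + v)⁻¹ :=
      inv_anti₀ (by linarith) (by linarith [Real.add_one_le_exp v])
    have h6 : (1 + v)⁻¹ ≤ 1 - v / 2 := by
      rw [inv_le_iff_one_le_mul₀ (by linarith)]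
      nlinarith
    nlinarith
  have hC : (0.3 : ℝ) * (0.34 * u) ≤ (1 - p) ^ k * (1 - (1 - p) ^ d) :=
    mul_le_mul hA hB (by positivity) (by linarith)
  have hD : (d / (10 * k) : ℝ) = u / 10 := by
    rw [hu]
    field_simp
  rw [hD]
  have := Real.one_sub_le_exp_neg (u / 10)
  linarith

variable {T l b k : ℕ}

/-- The codewords that are not all-zero and are used for the index vector `x`. -/
def support (x : Fin T → Fin (l + 1)) : Finset (Fin T × Fin l) :=
  Finset.univ.filter fun p => x p.1 = p.2.succ

theorem mem_support {x : Fin T → Fin (l + 1)} {p : Fin T × Fin l} :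
    p ∈ support x ↔ x p.1 = p.2.succ := by
  simp [support]

theorem IsSelection.card_support {x : Fin T → Fin (l + 1)} (hx : IsSelection k x) :
    (support x).card = k := by
  rw [← hx]
  refine Finset.card_bij (fun p _ => p.1) ?_ ?_ ?_
  · intro p hp
    rw [mem_support] at hp
    simp [hp]
  · rintro ⟨i, j⟩ hp ⟨i', j'⟩ hp' h
    simp only [mem_support] at hp hp' h
    subst h
    rw [hp] at hp'
    simpa using hp'
  · intro i hi
    simp only [Finset.mem_filter, Finset.mem_univ, true_and] at hi
    exact ⟨(i, (x i).pred hi), by simp [mem_support], rfl⟩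

/-- A differing position contributes a codeword to one of the two support differences, and these
have equal size because both supports have size `k`. -/
theorem hammingDist_le_of_isSelection {x x' : Fin T → Fin (l + 1)} (hx : IsSelection k x)
    (hx' : IsSelection k x') : hammingDist x x' ≤ 2 * (support x' \ support x).card := by
  have hsub : (Finset.univ.filter fun i => x i ≠ x' i)
      ⊆ (support x \ support x').image Prod.fst ∪ (support x' \ support x).image Prod.fst := by
    intro i hi
    simp only [Finset.mem_filter, Finset.mem_univ, true_and] at hi
    simp only [Finset.mem_union, Finset.mem_image, Finset.mem_sdiff, mem_support]
    by_cases h0 : x' i = 0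
    · have h1 : x i ≠ 0 := fun h => hi (h.trans h0.symm)
      exact Or.inl ⟨(i, (x i).pred h1), ⟨by simp, by simpa using hi.symm⟩, rfl⟩
    · exact Or.inr ⟨(i, (x' i).pred h0), ⟨by simp, by simpa using hi⟩, rfl⟩
  have hcomm : (support x \ support x').card = (support x' \ support x).card :=
    Finset.card_sdiff_comm (hx.card_support.trans hx'.card_support.symm)
  calc hammingDist x x' ≤ _ := Finset.card_le_card hsub
    _ ≤ _ := Finset.card_union_le _ _
    _ ≤ (support x \ support x').card + (support x' \ support x).card :=
        Nat.add_le_add Finset.card_image_le Finset.card_image_le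
    _ = _ := by rw [hcomm, two_mul]

theorem register_eq_true_iff_support (c : Codebook T l b) (x : Fin T → Fin (l + 1)) (t : Fin b) :
    register c x t = true ↔ ∃ p ∈ support x, c p.1 p.2 t = true := by
  rw [register_eq_true]
  simp only [mem_support, Prod.exists]

/-- Regroups the bits by register position: equality of registers becomes a product event over `b`
independent columns. -/
theorem map_codebookLaw (T l b k : ℕ) :
    (codebookLaw T l b k).map (fun c t (p : Fin T × Fin l) => c p.1 p.2 t)
      = Measure.pi fun _ : Fin b => bitsLaw (Fin T × Fin l) k := by
  apply Measure.ext_of_singleton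
  intro a
  rw [Measure.map_apply (measurable_of_countable _) (measurableSet_singleton _)]
  have hpre : (fun (c : Codebook T l b) t (p : Fin T × Fin l) => c p.1 p.2 t) ⁻¹' {a}
      = {fun i j t => a t (i, j)} := by
    ext c
    simp only [Set.mem_preimage, Set.mem_singleton_iff, funext_iff, Prod.forall]
    exact ⟨fun h i j t => h t i j, fun h t i j => h i j t⟩
  rw [hpre, codebookLaw, Measure.pi_singleton, Measure.pi_singleton]
  simp only [Measure.pi_singleton, bitsLaw, Fintype.prod_prod_type]
  symm
  rw [Finset.prod_comm]
  exact Finset.prod_congr rfl fun i _ => Finset.prod_comm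

theorem codebookLaw_real_register_eq_le {x x' : Fin T → Fin (l + 1)} (hk : 1 ≤ k)
    (hx : IsSelection k x) (hx' : IsSelection k x') :
    (codebookLaw T l b k).real {c | register c x' = register c x}
      ≤ Real.exp (-(hammingDist x x' * b / (20 * k) : ℝ)) := by
  set E : Set (Fin T × Fin l → Bool) :=
    {a | (∃ p ∈ support x, a p = true) ↔ ∃ p ∈ support x', a p = true} with hE
  have hset : {c : Codebook T l b | register c x' = register c x}
      = (fun c t (p : Fin T × Fin l) => c p.1 p.2 t) ⁻¹' Set.pi Set.univ fun _ => E := by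
    ext c
    simp only [Set.mem_ofPred_eq, Set.mem_preimage, Set.mem_pi, Set.mem_univ, forall_const, hE,
      ← register_eq_true_iff_support]
    rw [eq_comm, funext_iff]
    exact forall_congr' fun t => Bool.coe_iff_coe.symm
  have hd : (support x' \ support x).card ≤ k :=
    (Finset.card_le_card Finset.sdiff_subset).trans hx'.card_support.le
  have hbit : (bitsLaw (Fin T × Fin l) k).real E
      ≤ Real.exp (-(hammingDist x x' / (20 * k) : ℝ)) := by
    refine (bitsLaw_real_exists_iff_le k _ _).trans ?_
    rw [hx.card_support]
    refine (agreement_le_exp hk hd).trans ?_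
    rw [Real.exp_le_exp, neg_le_neg_iff, div_le_div_iff₀ (by positivity) (by positivity)]
    have : (hammingDist x x' : ℝ) ≤ 2 * (support x' \ support x).card := by
      exact_mod_cast hammingDist_le_of_isSelection hx hx'
    have hk0 : (0 : ℝ) ≤ 10 * k := by positivity
    nlinarith [mul_le_mul_of_nonneg_right this hk0]
  rw [hset, measureReal_def, ← Measure.map_apply (measurable_of_countable _)
    MeasurableSet.of_discrete, map_codebookLaw, Measure.pi_pi, ENNReal.toReal_prod]
  simp only [← measureReal_def, Finset.prod_const, Finset.card_univ, Fintype.card_fin]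
  calc _ ≤ Real.exp (-(hammingDist x x' / (20 * k) : ℝ)) ^ b :=
        pow_le_pow_left₀ measureReal_nonneg hbit b
    _ = _ := by
        rw [← Real.exp_nat_mul]
        congr 1
        ring

/-- The weight factors over coordinates: `1` for the agreeing value and `r` for each of the `l`
others. -/
theorem sum_pow_hammingDist (x : Fin T → Fin (l + 1)) (r : ℝ) :
    ∑ x', r ^ hammingDist x x' = (1 + l * r) ^ T := by
  have h : ∀ x', r ^ hammingDist x x' = ∏ i, if x i = x' i then 1 else r := by
    intro x'
    rw [hammingDist, Finset.prod_ite]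
    simp
  simp only [h]
  have := Finset.prod_univ_sum (fun _ : Fin T => (Finset.univ : Finset (Fin (l + 1))))
    (fun i j => if x i = j then (1 : ℝ) else r)
  rw [Fintype.piFinset_univ] at this
  rw [← this]
  have hs : ∀ i, ∑ j : Fin (l + 1), (if x i = j then (1 : ℝ) else r) = 1 + l * r := by
    intro i
    rw [← Finset.add_sum_erase _ _ (Finset.mem_univ (x i)), if_pos rfl,
      Finset.sum_congr rfl (g := fun _ => r)
        (fun j hj => if_neg (Finset.ne_of_mem_erase hj).symm)]
    simp
  simp [hs]

theorem sq_mul_exp_neg_clog_le (hT : 1 ≤ T) (hl : 1 ≤ l) :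
    Real.exp (-(2 * (Nat.clog 2 T + Nat.clog 2 l)) : ℝ) ≤ 1 / ((T : ℝ) ^ 2 * (l : ℝ) ^ 2) := by
  have h1 : (T : ℝ) ≤ 2 ^ Nat.clog 2 T := by exact_mod_cast Nat.le_pow_clog (by norm_num) T
  have h2 : (l : ℝ) ≤ 2 ^ Nat.clog 2 l := by exact_mod_cast Nat.le_pow_clog (by norm_num) l
  have h3 : (2 : ℝ) ≤ Real.exp 1 := by linarith [Real.add_one_le_exp (1 : ℝ)]
  have h4 : ∀ n : ℕ, (2 : ℝ) ^ n ≤ Real.exp n := fun n => by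
    rw [← Real.exp_one_pow]
    exact pow_le_pow_left₀ (by norm_num) h3 n
  have hT0 : (0 : ℝ) < T := by exact_mod_cast hT
  have hl0 : (0 : ℝ) < l := by exact_mod_cast hl
  rw [Real.exp_neg, ← one_div]
  apply one_div_le_one_div_of_le (by positivity)
  have h5 : (T : ℝ) * l ≤ Real.exp (Nat.clog 2 T) * Real.exp (Nat.clog 2 l) :=
    mul_le_mul (h1.trans (h4 _)) (h2.trans (h4 _)) hl0.le (Real.exp_pos _).le
  rw [← Real.exp_add] at h5
  calc (T : ℝ) ^ 2 * (l : ℝ) ^ 2 = (T * l) ^ 2 := by ring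
    _ ≤ Real.exp (Nat.clog 2 T + Nat.clog 2 l) ^ 2 := pow_le_pow_left₀ (by positivity) h5 2
    _ = _ := by
      rw [← Real.exp_nat_mul]
      norm_num

/-- Union bound over the competitors. Dropping the constraint that they have `k` non-zero entries
turns the sum into a closed form, and `r` is small enough to afford it. -/
theorem codebookLaw_real_ambiguous_le (hk : 1 ≤ k) (hT : 1 ≤ T) (hl : 1 ≤ l)
    {x : Fin T → Fin (l + 1)} (hx : IsSelection k x) :
    (codebookLaw T l (registerSize T k l) k).real
      {c | ∃ x', x' ≠ x ∧ IsSelection k x' ∧ register c x' = register c x}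
      ≤ Real.exp (1 / T) - 1 := by
  classical
  set r : ℝ := Real.exp (-(2 * (Nat.clog 2 T + Nat.clog 2 l)) : ℝ) with hr
  have hT0 : (0 : ℝ) < T := by exact_mod_cast hT
  have hl0 : (1 : ℝ) ≤ l := by exact_mod_cast hl
  have hk0 : (0 : ℝ) < k := by exact_mod_cast hk
  set F : Finset (Fin T → Fin (l + 1)) :=
    Finset.univ.filter (fun x' => x' ≠ x ∧ IsSelection k x') with hF
  have hset : {c : Codebook T l (registerSize T k l) |
      ∃ x', x' ≠ x ∧ IsSelection k x' ∧ register c x' = register c x}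
      = ⋃ x' ∈ F, {c | register c x' = register c x} := by
    ext c
    simp [hF, and_assoc]
  have hterm : ∀ x' ∈ F, (codebookLaw T l (registerSize T k l) k).real
      {c | register c x' = register c x} ≤ r ^ hammingDist x x' := by
    intro x' hx'
    simp only [hF, Finset.mem_filter, Finset.mem_univ, true_and] at hx'
    refine (codebookLaw_real_register_eq_le hk hx hx'.2).trans (le_of_eq ?_)
    -- The factor `40 * k` in the register size against `20 * k` in the exponent leaves the `2` in
    -- `r`.
    rw [hr, ← Real.exp_nat_mul, registerSize]
    congr 1
    push_cast
    field_simp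
    ring
  rw [hset]
  have hlr : 1 + l * r ≤ Real.exp (1 / (T : ℝ) ^ 2) := by
    have h1 : r ≤ 1 / ((T : ℝ) ^ 2 * (l : ℝ) ^ 2) := sq_mul_exp_neg_clog_le hT hl
    have h2 : l * r ≤ 1 / (T : ℝ) ^ 2 := by
      calc l * r ≤ l * (1 / ((T : ℝ) ^ 2 * (l : ℝ) ^ 2)) :=
            mul_le_mul_of_nonneg_left h1 (by linarith)
        _ = 1 / (T : ℝ) ^ 2 * (1 / l) := by field_simp
        _ ≤ 1 / (T : ℝ) ^ 2 * 1 := by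
            apply mul_le_mul_of_nonneg_left _ (by positivity)
            rw [div_le_one (by linarith)]
            exact hl0
        _ = _ := mul_one _
    linarith [Real.add_one_le_exp (1 / (T : ℝ) ^ 2)]
  have hr0 : 0 ≤ r := (Real.exp_pos _).le
  calc _ ≤ ∑ x' ∈ F, _ := measureReal_biUnion_finset_le _ _
    _ ≤ ∑ x' ∈ F, r ^ hammingDist x x' := Finset.sum_le_sum hterm
    _ ≤ ∑ x' ∈ Finset.univ.erase x, r ^ hammingDist x x' := by
        apply Finset.sum_le_sum_of_subset_of_nonneg
        · intro x' hx'
          simp only [hF, Finset.mem_filter, Finset.mem_univ, true_and] at hx'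
          simpa using hx'.1
        · intros
          positivity
    _ = (1 + l * r) ^ T - 1 := by
        rw [← sum_pow_hammingDist x r, ← Finset.add_sum_erase _ _ (Finset.mem_univ x)]
        simp
    _ ≤ Real.exp (1 / (T : ℝ) ^ 2) ^ T - 1 := by
        have := pow_le_pow_left₀ (by positivity) hlr T
        linarith
    _ = _ := by
        rw [← Real.exp_nat_mul]
        congr 2
        field_simp

theorem IsMLSelection.register_eq {c : Codebook T l b} {x x' : Fin T → Fin (l + 1)}
    (h : IsMLSelection k c (register c x) x') (hx : IsSelection k x) :
    register c x' = register c x := by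
  have := h.2 x hx
  rw [likelihood_eq, likelihood_eq, if_pos rfl] at this
  by_contra hne
  rw [if_neg hne] at this
  simp at this

theorem measurable_labels (Q : Quantizer l) : Measurable (Q.labels (T := T)) :=
  measurable_pi_lambda _ fun i => Q.measurable_label.comp (measurable_pi_apply i)

/-- The decoder is an arbitrary function, but the signal enters only through its labels, so
everything factors through a countable discrete space. -/
theorem measurable_comp_labels {α : Type*} [MeasurableSpace α] (Q : Quantizer l)
    (f : Codebook T l b → (Fin T → Fin (l + 1)) → α) :
    Measurable fun ω : (Fin T → ℝ) × Codebook T l b => f ω.2 (Q.labels ω.1) :=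
  (measurable_of_countable fun p : (Fin T → Fin (l + 1)) × Codebook T l b => f p.2 p.1).comp
    (((measurable_labels Q).comp measurable_fst).prodMk measurable_snd)

theorem measurableSet_error (Q : Quantizer l) (k : ℕ)
    (dec : Codebook T l b → Word b → Fin T → Fin (l + 1)) :
    MeasurableSet {ω : (Fin T → ℝ) × Codebook T l b |
      IsSelection k (Q.labels ω.1) ∧ dec ω.2 (encode Q ω.2 ω.1) ≠ Q.labels ω.1} :=
  measurable_comp_labels (α := Prop) Q
    (fun c x => IsSelection k x ∧ dec c (register c x) ≠ x) |>.setOf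

theorem errorProb_le (hk : 1 ≤ k) (hT : 1 ≤ T) (hl : 1 ≤ l) (Q : Quantizer l)
    (μ : Measure (Fin T → ℝ)) [IsProbabilityMeasure μ]
    (dec : Codebook T l (registerSize T k l) → Word (registerSize T k l) → Fin T → Fin (l + 1))
    (hdec : ∀ c y, IsMLSelection k c y (dec c y)) :
    errorProb k Q μ dec ≤ ENNReal.ofReal (Real.exp (1 / T) - 1) := by
  rw [errorProb, Measure.prod_apply (measurableSet_error Q k dec)]
  have hs : ∀ s, codebookLaw T l (registerSize T k l) k (Prod.mk s ⁻¹'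
      {ω | IsSelection k (Q.labels ω.1) ∧ dec ω.2 (encode Q ω.2 ω.1) ≠ Q.labels ω.1})
        ≤ ENNReal.ofReal (Real.exp (1 / T) - 1) := by
    intro s
    by_cases hx : IsSelection k (Q.labels s)
    · refine (measure_mono ?_).trans (ENNReal.le_ofReal_iff_toReal_le (measure_ne_top _ _)
        ?_ |>.2 (codebookLaw_real_ambiguous_le hk hT hl hx))
      · rintro c ⟨-, hc⟩
        exact ⟨_, hc, (hdec c _).1, (hdec c _).register_eq hx⟩
      · have : (0 : ℝ) ≤ 1 / T := by positivity
        linarith [Real.one_le_exp this]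
    · have : Prod.mk s ⁻¹' {ω : (Fin T → ℝ) × Codebook T l (registerSize T k l) |
          IsSelection k (Q.labels ω.1) ∧ dec ω.2 (encode Q ω.2 ω.1) ≠ Q.labels ω.1} = ∅ := by
        ext c
        simp [hx]
      rw [this]
      simp
  calc _ ≤ ∫⁻ _, ENNReal.ofReal (Real.exp (1 / T) - 1) ∂μ := lintegral_mono hs
    _ = _ := by simp

theorem tendsto_exp_inv_sub_one :
    Tendsto (fun T : ℕ => Real.exp (1 / (T : ℝ)) - 1) atTop (𝓝 0) := by
  simpa [Function.comp_def] using ((Real.continuous_exp.tendsto 0).comp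
    tendsto_one_div_atTop_nhds_zero_nat).sub_const 1

end SQuaTS

/-! ### From wrong indices to excess distortion. -/

namespace SQuaTS

theorem integrable_sub_sq {Ω : Type*} [MeasurableSpace Ω] {μ : Measure Ω} [IsFiniteMeasure μ]
    {X h : Ω → ℝ} {M : ℝ} (hX : Measurable X) (hX2 : Integrable (fun ω => X ω ^ 2) μ)
    (hh : Measurable h) (hM : ∀ ω, |h ω| ≤ M) : Integrable (fun ω => (X ω - h ω) ^ 2) μ := by
  refine Integrable.mono' (g := fun ω => 2 * X ω ^ 2 + 2 * M ^ 2)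
    ((hX2.const_mul 2).add (integrable_const _))
    ((hX.sub hh).pow_const 2).aestronglyMeasurable (Eventually.of_forall fun ω => ?_)
  rw [Real.norm_of_nonneg (sq_nonneg _)]
  have h1 : h ω ^ 2 ≤ M ^ 2 := sq_le_sq' (abs_le.1 (hM ω)).1 (abs_le.1 (hM ω)).2
  nlinarith [sq_nonneg (X ω + h ω)]

/-- The term linear in `|s|` is split by Young's inequality: `δ` weighs the power, `1 / δ` the
constant that is paid only where an index is wrong. -/
theorem abs_sub_sq_sub_sub_sq_le {s p q M δ : ℝ} (hp : |p| ≤ M) (hq : |q| ≤ M) (hδ : 0 < δ) :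
    |(s - p) ^ 2 - (s - q) ^ 2| ≤ 4 * M * δ * s ^ 2 + (M / δ + 4 * M ^ 2) := by
  have hM : 0 ≤ M := (abs_nonneg _).trans hp
  have h1 : |(s - p) ^ 2 - (s - q) ^ 2| = |q - p| * |2 * s - p - q| := by
    rw [← abs_mul]
    congr 1
    ring
  have h2 : |q - p| ≤ 2 * M := (abs_sub _ _).trans (by linarith)
  have h3 : |2 * s - p - q| ≤ 2 * |s| + 2 * M := by
    have e1 := abs_sub (2 * s - p) q
    have e2 := abs_sub (2 * s) p
    rw [abs_mul, abs_two] at e2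
    linarith
  have h4 : |s| ≤ δ * s ^ 2 + 1 / (4 * δ) := by
    have h5 : 0 ≤ (2 * δ * |s| - 1) ^ 2 / (4 * δ) := by positivity
    have h6 : (2 * δ * |s| - 1) ^ 2 / (4 * δ) = δ * |s| ^ 2 + 1 / (4 * δ) - |s| := by
      field_simp
      ring
    rw [sq_abs] at h6
    linarith
  rw [h1]
  calc _ ≤ 2 * M * (2 * |s| + 2 * M) := mul_le_mul h2 h3 (abs_nonneg _) (by linarith)
    _ ≤ 2 * M * (2 * (δ * s ^ 2 + 1 / (4 * δ)) + 2 * M) := by gcongr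
    _ = _ := by
      field_simp
      ring

variable {T l b k : ℕ}

theorem abs_systemMSE_sub_scalarMSE_le (Q : Quantizer l) {M : ℝ} (hM : ∀ j, |Q.level j| ≤ M)
    (μ : Measure (Fin T → ℝ)) [IsProbabilityMeasure μ]
    (dec : Codebook T l b → Word b → Fin T → Fin (l + 1))
    (hint : ∀ i, Integrable (fun s => s i ^ 2) μ) {P : ℝ}
    (hP : (1 / (T : ℝ)) * ∑ i, ∫ s, s i ^ 2 ∂μ ≤ P) {ε : ℝ} (hε : 0 < ε)
    (he : ∫ ω, (hammingDist (dec ω.2 (encode Q ω.2 ω.1)) (Q.labels ω.1) : ℝ) / T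
      ∂(μ.prod (codebookLaw T l b k)) ≤ ε) :
    |systemMSE k Q μ dec - scalarMSE Q μ| ≤ (4 * P + 1) * M * √ε + 4 * M ^ 2 * ε := by
  set ρ := μ.prod (codebookLaw T l b k) with hρ
  -- This choice gives `δ` and `ε / δ`, the two competing contributions, the same order.
  set δ := √ε with hδdef
  have hδ : 0 < δ := Real.sqrt_pos.2 hε
  have hM0 : 0 ≤ M := (abs_nonneg _).trans (hM 0)
  let f : Fin T → (Fin T → ℝ) × Codebook T l b → ℝ :=
    fun i ω => (ω.1 i - Q.level (dec ω.2 (encode Q ω.2 ω.1) i)) ^ 2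
  let g : Fin T → (Fin T → ℝ) × Codebook T l b → ℝ :=
    fun i ω => (ω.1 i - Q.level (Q.label (ω.1 i))) ^ 2
  let N : (Fin T → ℝ) × Codebook T l b → ℝ :=
    fun ω => (hammingDist (dec ω.2 (encode Q ω.2 ω.1)) (Q.labels ω.1) : ℝ)
  have hcoord : ∀ i, Measurable fun ω : (Fin T → ℝ) × Codebook T l b => ω.1 i :=
    fun i => (measurable_pi_apply i).comp measurable_fst
  have hsq : ∀ i, Integrable (fun ω : (Fin T → ℝ) × Codebook T l b => ω.1 i ^ 2) ρ :=
    fun i => (hint i).comp_fst _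
  have hf : ∀ i, Integrable (f i) ρ := fun i =>
    integrable_sub_sq (hcoord i) (hsq i)
      (measurable_comp_labels Q fun c x => Q.level (dec c (register c x) i)) fun _ => hM _
  have hg : ∀ i, Integrable (g i) ρ := fun i =>
    integrable_sub_sq (hcoord i) (hsq i)
      (measurable_comp_labels Q fun _ x => Q.level (x i)) fun _ => hM _
  have hN : Integrable N ρ := by
    refine Integrable.of_bound (measurable_comp_labels Q fun c x =>
      (hammingDist (dec c (register c x)) x : ℝ)).aestronglyMeasurable T
        (Eventually.of_forall fun ω => ?_)
    rw [Real.norm_of_nonneg (Nat.cast_nonneg _)]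
    exact_mod_cast hammingDist_le_card_fintype.trans (Fintype.card_fin T).le
  have hscalar : scalarMSE Q μ = ∫ ω, (1 / (T : ℝ)) * ∑ i, g i ω ∂ρ := by
    rw [integral_const_mul, integral_finsetSum _ fun i _ => hg i, scalarMSE]
    congr 1
    refine Finset.sum_congr rfl fun i _ => ?_
    have := integral_fun_fst (μ := μ) (ν := codebookLaw T l b k)
      (fun s : Fin T → ℝ => (s i - Q.level (Q.label (s i))) ^ 2)
    rw [probReal_univ, one_smul] at this
    exact this.symm
  have hF : Integrable (fun ω => (1 / (T : ℝ)) * ∑ i, f i ω) ρ :=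
    (integrable_finsetSum _ fun i _ => hf i).const_mul _
  have hG : Integrable (fun ω => (1 / (T : ℝ)) * ∑ i, g i ω) ρ :=
    (integrable_finsetSum _ fun i _ => hg i).const_mul _
  have hS : Integrable (fun ω : (Fin T → ℝ) × Codebook T l b =>
      (1 / (T : ℝ)) * ∑ i, ω.1 i ^ 2) ρ :=
    (integrable_finsetSum _ fun i _ => hsq i).const_mul _
  have hpt : ∀ ω, |(1 / (T : ℝ)) * ∑ i, f i ω - (1 / (T : ℝ)) * ∑ i, g i ω|
      ≤ 4 * M * δ * ((1 / (T : ℝ)) * ∑ i, ω.1 i ^ 2) + (M / δ + 4 * M ^ 2) * (N ω / T) := by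
    intro ω
    have hi : ∀ i, |f i ω - g i ω| ≤ 4 * M * δ * ω.1 i ^ 2 + (M / δ + 4 * M ^ 2) *
        (if dec ω.2 (encode Q ω.2 ω.1) i ≠ Q.labels ω.1 i then 1 else 0) := by
      intro i
      split_ifs with h
      · rw [mul_one]
        exact abs_sub_sq_sub_sub_sq_le (hM _) (hM _) hδ
      · have h' : dec ω.2 (encode Q ω.2 ω.1) i = Q.label (ω.1 i) := not_not.1 h
        simp only [f, g, h', sub_self, abs_zero]
        positivity
    have hsum : ∑ i, (if dec ω.2 (encode Q ω.2 ω.1) i ≠ Q.labels ω.1 i then (1 : ℝ) else 0)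
        = N ω := by
      rw [Finset.sum_boole]
      rfl
    rw [← mul_sub, ← Finset.sum_sub_distrib, abs_mul, abs_of_nonneg (by positivity)]
    calc _ ≤ 1 / (T : ℝ) * ∑ i, (4 * M * δ * ω.1 i ^ 2 + (M / δ + 4 * M ^ 2) *
        (if dec ω.2 (encode Q ω.2 ω.1) i ≠ Q.labels ω.1 i then 1 else 0)) := by
          gcongr
          exact (Finset.abs_sum_le_sum_abs _ _).trans (Finset.sum_le_sum fun i _ => hi i)
      _ = _ := by
          rw [Finset.sum_add_distrib, ← Finset.mul_sum, ← Finset.mul_sum, hsum]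
          ring
  have hpow : ∫ ω, (1 / (T : ℝ)) * ∑ i, ω.1 i ^ 2 ∂ρ ≤ P := by
    rw [integral_const_mul, integral_finsetSum _ fun i _ => hsq i]
    refine le_of_eq_of_le ?_ hP
    congr 1
    refine Finset.sum_congr rfl fun i _ => ?_
    have := integral_fun_fst (μ := μ) (ν := codebookLaw T l b k) (fun s : Fin T → ℝ => s i ^ 2)
    rw [probReal_univ, one_smul] at this
    exact this
  have hsub : systemMSE k Q μ dec - scalarMSE Q μ
      = ∫ ω, ((1 / (T : ℝ)) * ∑ i, f i ω - (1 / (T : ℝ)) * ∑ i, g i ω) ∂ρ := by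
    rw [hscalar, integral_sub hF hG]
    rfl
  rw [hsub]
  calc _ ≤ ∫ ω, |(1 / (T : ℝ)) * ∑ i, f i ω - (1 / (T : ℝ)) * ∑ i, g i ω| ∂ρ :=
        abs_integral_le_integral_abs
    _ ≤ ∫ ω, (4 * M * δ * ((1 / (T : ℝ)) * ∑ i, ω.1 i ^ 2)
          + (M / δ + 4 * M ^ 2) * (N ω / T)) ∂ρ :=
        integral_mono (hF.sub hG).abs
          ((hS.const_mul _).add ((hN.div_const _).const_mul _)) hpt
    _ = 4 * M * δ * (∫ ω, (1 / (T : ℝ)) * ∑ i, ω.1 i ^ 2 ∂ρ)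
          + (M / δ + 4 * M ^ 2) * ∫ ω, N ω / T ∂ρ := by
        rw [integral_add (hS.const_mul _) ((hN.div_const _).const_mul _),
          integral_const_mul (4 * M * δ), integral_const_mul (M / δ + 4 * M ^ 2)]
    _ ≤ 4 * M * δ * P + (M / δ + 4 * M ^ 2) * ε := by gcongr
    _ = _ := by
        have : ε = δ * δ := (Real.mul_self_sqrt hε.le).symm
        have h2 : M / δ * ε = M * δ := by
          rw [this]
          field_simp
        rw [add_mul, h2]
        ring

/-- The fraction of wrong indices is at most `1`, and almost surely it vanishes off the error event.
-/
theorem integral_hammingDist_div_le_of_exact (Q : Quantizer l)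
    (μ : Measure (Fin T → ℝ)) [IsProbabilityMeasure μ]
    (dec : Codebook T l b → Word b → Fin T → Fin (l + 1))
    (hμ : ∀ᵐ s ∂μ, IsSelection k (Q.labels s)) :
    ∫ ω, (hammingDist (dec ω.2 (encode Q ω.2 ω.1)) (Q.labels ω.1) : ℝ) / T
      ∂(μ.prod (codebookLaw T l b k)) ≤ (errorProb k Q μ dec).toReal := by
  have hE := measurableSet_error Q k dec
  rw [errorProb, ← measureReal_def, ← integral_indicator_one hE]
  refine integral_mono_of_nonneg (Eventually.of_forall fun ω => by positivity)
    ((integrable_const (1 : ℝ)).indicator hE) ?_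
  filter_upwards [Measure.quasiMeasurePreserving_fst.ae hμ] with ω hω
  by_cases h : dec ω.2 (encode Q ω.2 ω.1) = Q.labels ω.1
  · rw [h, hammingDist_self, Nat.cast_zero, zero_div]
    exact Set.indicator_nonneg (fun _ _ => zero_le_one) _
  · have hω' : ω ∈ {ω : (Fin T → ℝ) × Codebook T l b |
        IsSelection k (Q.labels ω.1) ∧ dec ω.2 (encode Q ω.2 ω.1) ≠ Q.labels ω.1} := ⟨hω, h⟩
    rw [Set.indicator_of_mem hω']
    refine div_le_one_of_le₀ ?_ (Nat.cast_nonneg _)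
    exact_mod_cast hammingDist_le_card_fintype.trans (Fintype.card_fin T).le

/-- No recovery is needed: the true and the decoded vector each have at most `k` non-zero indices,
since `0` is labelled `0`, so they differ in at most `2 * k` places. -/
theorem integral_hammingDist_div_le_of_sparse (Q : Quantizer l) {K : ℕ} (hK : k ≤ K)
    (μ : Measure (Fin T → ℝ)) [IsProbabilityMeasure μ]
    (dec : Codebook T l b → Word b → Fin T → Fin (l + 1))
    (hdec : ∀ c y, IsSelection k (dec c y))
    (hμ : ∀ᵐ s ∂μ, (Finset.univ.filter (fun i => s i ≠ 0)).card ≤ k) :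
    ∫ ω, (hammingDist (dec ω.2 (encode Q ω.2 ω.1)) (Q.labels ω.1) : ℝ) / T
      ∂(μ.prod (codebookLaw T l b k)) ≤ 2 * K / T := by
  have h : ∀ᵐ ω ∂(μ.prod (codebookLaw T l b k)),
      (hammingDist (dec ω.2 (encode Q ω.2 ω.1)) (Q.labels ω.1) : ℝ) / T ≤ 2 * K / T := by
    filter_upwards [Measure.quasiMeasurePreserving_fst.ae hμ] with ω hω
    gcongr
    have hx : hammingDist (0 : Fin T → Fin (l + 1)) (Q.labels ω.1) ≤ k := by
      rw [hammingDist_comm]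
      refine (Finset.card_le_card ?_).trans hω
      intro i
      simp only [Finset.mem_filter, Finset.mem_univ, true_and]
      intro hi h0
      exact hi (by rw [Quantizer.labels, h0, Q.label_zero, Pi.zero_apply])
    have hd : hammingDist (dec ω.2 (encode Q ω.2 ω.1)) 0 = k := hdec _ _
    have := hammingDist_triangle (dec ω.2 (encode Q ω.2 ω.1)) 0 (Q.labels ω.1)
    exact_mod_cast (by omega :
      hammingDist (dec ω.2 (encode Q ω.2 ω.1)) (Q.labels ω.1) ≤ 2 * K)
  calc _ ≤ ∫ _, (2 * K / T : ℝ) ∂(μ.prod (codebookLaw T l b k)) :=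
        integral_mono_of_nonneg (Eventually.of_forall fun ω => by positivity)
          (integrable_const _) h
    _ = _ := by simp

/-- If the expected fraction of wrong indices vanishes and the average power is bounded, then the
excess of the MSE over the MSE of the scalar quantizer vanishes. -/
theorem tendsto_systemMSE_sub_scalarMSE {b k : ℕ → ℕ} (Q : Quantizer l)
    (dec : ∀ T : ℕ, Codebook T l (b T) → Word (b T) → Fin T → Fin (l + 1))
    (μ : ∀ T : ℕ, Measure (Fin T → ℝ)) (hμ : ∀ T, IsProbabilityMeasure (μ T)) {P : ℝ}
    (hP : ∀ᶠ T in atTop, (∀ i, Integrable (fun s => s i ^ 2) (μ T)) ∧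
      (1 / (T : ℝ)) * ∑ i, ∫ s, s i ^ 2 ∂(μ T) ≤ P)
    {ε : ℕ → ℝ} (hε : Tendsto ε atTop (𝓝 0)) (hpos : ∀ᶠ T in atTop, 0 < ε T)
    (he : ∀ᶠ T in atTop, ∫ ω, (hammingDist (dec T ω.2 (encode Q ω.2 ω.1)) (Q.labels ω.1) : ℝ) / T
      ∂((μ T).prod (codebookLaw T l (b T) (k T))) ≤ ε T) :
    Tendsto (fun T => systemMSE (k T) Q (μ T) (dec T) - scalarMSE Q (μ T)) atTop (𝓝 0) := by
  set M := ∑ j, |Q.level j| with hMdef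
  have hM : ∀ j, |Q.level j| ≤ M := fun j =>
    Finset.single_le_sum (f := fun j => |Q.level j|) (fun _ _ => abs_nonneg _) (Finset.mem_univ j)
  refine squeeze_zero_norm' (a := fun T => (4 * P + 1) * M * √(ε T) + 4 * M ^ 2 * ε T) ?_ ?_
  · filter_upwards [hP, hpos, he] with T hPT hposT heT
    exact abs_systemMSE_sub_scalarMSE_le Q hM (μ T) (dec T) hPT.1 hPT.2 hposT heT
  · have h1 : Tendsto (fun T => √(ε T)) atTop (𝓝 0) := by
      simpa [Function.comp_def] using (Real.continuous_sqrt.tendsto 0).comp hε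
    simpa using (h1.const_mul ((4 * P + 1) * M)).add (hε.const_mul (4 * M ^ 2))

end SQuaTS

/-! ### The main theorem. -/

open SQuaTS in
theorem corollary3 :
    ∃ (C : ℝ) (b : ℕ → ℕ → ℕ → ℕ),
      -- register size, and complexity of the ML decoder
      (∀ T k l : ℕ, 1 ≤ k → k < T → 1 ≤ l →
        (b T k l : ℝ) ≤ C * (k * Real.logb 2 T + k * Real.logb 2 l) ∧
        ∀ (c : Codebook T l (b T k l)) (y : Word (b T k l)),
          IsMLSelection k c y (mlDecode k c y).val ∧
          ((mlDecode k c y).ops : ℝ) ≤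
            C * ((T.choose k : ℝ) * (l : ℝ) ^ k * (k : ℝ) ^ 2 * Real.logb 2 T +
              (T.choose k : ℝ) * (l : ℝ) ^ k * (k : ℝ) ^ 2 * Real.logb 2 l)) ∧
      -- performance of every ML decoder with this register size
      ∀ (l : ℕ), 1 ≤ l → ∀ (Q : Quantizer l) (k : ℕ → ℕ),
        (∀ᶠ T in atTop, 1 ≤ k T ∧ k T < T) →
        ∀ (dec : ∀ T : ℕ, Codebook T l (b T (k T) l) → Word (b T (k T) l) →
            Fin T → Fin (l + 1)),
          (∀ᶠ T in atTop, ∀ c y, IsMLSelection (k T) c y (dec T c y)) →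
        ∀ (μ : ∀ T : ℕ, Measure (Fin T → ℝ)), (∀ T, IsProbabilityMeasure (μ T)) →
          -- recovery of the quantized samples
          Tendsto (fun T => errorProb (k T) Q (μ T) (dec T)) atTop (𝓝 0) ∧
          -- the MSE of the scalar quantizer is achieved
          ((∃ P : ℝ, ∀ᶠ T in atTop, (∀ i, Integrable (fun s => s i ^ 2) (μ T)) ∧
              (1 / (T : ℝ)) * ∑ i, ∫ s, s i ^ 2 ∂(μ T) ≤ P) →
            ((∃ K : ℕ, ∀ᶠ T in atTop, k T ≤ K ∧
                ∀ᵐ s ∂(μ T), (Finset.univ.filter (fun i => s i ≠ 0)).card ≤ k T) ∨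
              (∀ᶠ T in atTop, ∀ᵐ s ∂(μ T), IsSelection (k T) (Q.labels s))) →
            Tendsto (fun T => systemMSE (k T) Q (μ T) (dec T) - scalarMSE Q (μ T))
              atTop (𝓝 0)) := by
  refine ⟨400, registerSize, ?_, ?_⟩
  · intro T k l hk hkT hl
    refine ⟨(registerSize_le (by omega) hl).trans ?_, fun c y =>
      ⟨isMLSelection_mlDecode c y hkT.le hl, ops_mlDecode_registerSize_le hk hkT hl c y⟩⟩
    have h1 : 0 ≤ Real.logb 2 T :=
      Real.logb_nonneg (by norm_num) (by exact_mod_cast (by omega : 1 ≤ T))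
    have h2 : 0 ≤ Real.logb 2 l := Real.logb_nonneg (by norm_num) (by exact_mod_cast hl)
    exact mul_le_mul_of_nonneg_right (by norm_num) (by positivity)
  · intro l hl Q k hk dec hdec μ hμ
    have herr : ∀ᶠ T : ℕ in atTop, errorProb (k T) Q (μ T) (dec T)
        ≤ ENNReal.ofReal (Real.exp (1 / T) - 1) := by
      filter_upwards [hk, hdec] with T hkT hdecT
      exact errorProb_le hkT.1 (by omega) hl Q (μ T) (dec T) hdecT
    refine ⟨tendsto_of_tendsto_of_tendsto_of_le_of_le' tendsto_const_nhds
      (by simpa using ENNReal.tendsto_ofReal tendsto_exp_inv_sub_one) (Eventually.of_forall fun _ => zero_le) herr, ?_⟩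
    rintro ⟨P, hP⟩ (⟨K, hK⟩ | hexact)
    -- The `+ 1` makes `ε` strictly positive even for `K = 0`, as the division by `√ε` requires.
    · refine tendsto_systemMSE_sub_scalarMSE Q dec μ hμ hP
        (ε := fun T : ℕ => (2 * K + 1) / (T : ℝ)) (tendsto_const_div_atTop_nhds_zero_nat _) ?_ ?_
      · filter_upwards [eventually_gt_atTop 0] with T hT
        have : (0 : ℝ) < T := by exact_mod_cast hT
        positivity
      · filter_upwards [hK, hdec] with T hKT hdecT
        refine (integral_hammingDist_div_le_of_sparse Q hKT.1 (μ T) (dec T)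
          (fun c y => (hdecT c y).1) hKT.2).trans ?_
        gcongr
        linarith
    · have hpos : ∀ᶠ T : ℕ in atTop, 0 < Real.exp (1 / (T : ℝ)) - 1 := by
        filter_upwards [eventually_gt_atTop 0] with T hT
        have : (0 : ℝ) < T := by exact_mod_cast hT
        linarith [Real.one_lt_exp_iff.2 (one_div_pos.2 this)]
      refine tendsto_systemMSE_sub_scalarMSE Q dec μ hμ hP tendsto_exp_inv_sub_one hpos ?_
      filter_upwards [hexact, herr, hpos] with T hT herrT hposT
      exact (integral_hammingDist_div_le_of_exact Q (μ T) (dec T) hT).trans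
        (ENNReal.toReal_le_of_le_ofReal hposT.le herrT)
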